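/- Let $\mathcal X$ and $\mathcal Y$ be finite sets, and let $\Delta\subset\mathbb R^{\mathcal X}$ be the simplex of probability vectors on $\mathcal X$, written as row vectors. Let $e$ be the column vector of ones. Let $\mathcal M=\{M(y):y\in\mathcal Y\}$ be a family of nonnegative real $\mathcal X\times\mathcal X$ matrices whose sum $M=\sum_{y}M(y)$ is a Markov transition matrix (every row sums to $1$). For a word $\mathbf y=(y_1,\dots,y_n)$ put $M(\mathbf y)=M(y_1)\cdots M(y_n)$. The Markov chain on $\Delta$ that moves from $\alpha$ to $\alpha M(y)/\alpha M(y)e$ with probability $\alpha M(y)e$, $y\in\mathcal Y$, has transition kernel $$P(\alpha,A)=\sum_{y}\alpha M(y)e,$$ where the sum is over those $y\in\mathcal Y$ with $\alpha M(y)e\neq 0$ and $\alpha M(y)/\alpha M(y)e\in A$. Its Markov operator on the space $C(\Delta)$ of continuous real functions is $$(T_{\mathcal M}f)(\alpha)=\sum_{y}(\alpha M(y)e)\,f\!\left(\frac{\alpha M(y)}{\alpha M(y)e}\right),$$ where terms with $\alpha M(y)e=0$ are taken to be $0$. For a Borel probability measure $\mu$ on $\Delta$ let $T_{\mathcal M}^*\mu=\int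 P(\alpha,\cdot)\,\mu(d\alpha)$, so that $\int f\,d(T_{\mathcal M}^*\mu)=\int T_{\mathcal M}f\,d\mu$ for all $f\in C(\Delta)$. Call $\mu$ $T_{\mathcal M}$-invariant if $\int T_{\mathcal M}f\,d\mu=\int f\,d\mu$ for all $f\in C(\Delta)$. **Theorem A (Kaijser).** Suppose that $M$ is aperiodic, that is, there is a single $k\ge 1$ such that $(M^k)_{ij}>0$ for all $i,j\in\mathcal X$. Suppose that for some word $\mathbf y$ the matrix $M(\mathbf y)$ is nonzero and subrectangular, that is, there are $R,C\subseteq\mathcal X$ such that $M(\mathbf y)_{ij}>0$ if and only if $(i,j)\in R\times C$. Then there is a unique $T_{\mathcal M}$-invariant Borel probability measure $\lambda$ on $\Delta$, and for every Borel probability measure $\mu$ on $\Delta$ we have $(T_{\mathcal M}^*)^n\mu\to\lambda$ weakly as $n\to\infty$. -/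

import Mathlib

open MeasureTheory ProbabilityTheory Filter Topology

/-- The stepping matrices of a finite state hidden Markov model with hidden states `X` and
outputs `Y`: nonnegative matrices `M(y)`, `y ∈ Y`, whose sum is a Markov transition matrix. -/
structure SteppingFamily (X Y : Type*) [Fintype X] [Fintype Y] where
  /-- The stepping matrices. -/
  step : Y → Matrix X X ℝ
  nonneg : ∀ y i j, 0 ≤ step y i j
  row_sum : ∀ i, ∑ j, (∑ y, step y) i j = 1

/-- A matrix with real entries is subrectangular if its positive entries occupy exactly the
positions of a product `R × C` of a set of rows and a set of columns. -/
def IsSubrectangular {X : Type*} (D : Matrix X X ℝ) : Prop :=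
  ∃ R C : Set X, ∀ i j, 0 < D i j ↔ i ∈ R ∧ j ∈ C

namespace SteppingFamily

variable {X Y : Type*} [Fintype X] [Fintype Y]

/-- The transition matrix `M = ∑ y, M(y)` of the hidden chain. -/
def transition (H : SteppingFamily X Y) : Matrix X X ℝ := ∑ y, H.step y

/-- The matrix product `M(y₁) M(y₂) ⋯ M(yₙ)` of a word `y₁, …, yₙ`. -/
def word [DecidableEq X] (H : SteppingFamily X Y) (y : List Y) : Matrix X X ℝ :=
  (y.map H.step).prod

/-- The row vector `α M(y)`. -/
def push (H : SteppingFamily X Y) (y : Y) (α : stdSimplex ℝ X) : X → ℝ :=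
  Matrix.vecMul (α : X → ℝ) (H.step y)

/-- The number `α M(y) e`, where `e` is the column vector of ones: the probability that the
next output is `y`, given that the current hidden state has law `α`. -/
def weight (H : SteppingFamily X Y) (y : Y) (α : stdSimplex ℝ X) : ℝ := ∑ j, H.push y α j

theorem push_nonneg (H : SteppingFamily X Y) (y : Y) (α : stdSimplex ℝ X) (j : X) :
    0 ≤ H.push y α j :=
  Finset.sum_nonneg fun i _ => mul_nonneg (α.2.1 i) (H.nonneg y i j)

theorem weight_nonneg (H : SteppingFamily X Y) (y : Y) (α : stdSimplex ℝ X) :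
    0 ≤ H.weight y α :=
  Finset.sum_nonneg fun j _ => H.push_nonneg y α j

theorem sum_weight (H : SteppingFamily X Y) (α : stdSimplex ℝ X) : ∑ y, H.weight y α = 1 := by
  have h1 : ∀ i, ∑ y, ∑ j, H.step y i j = 1 := by
    intro i
    rw [Finset.sum_comm, ← H.row_sum i]
    simp [Matrix.sum_apply]
  have h2 : ∀ y, H.weight y α = ∑ i, α.1 i * ∑ j, H.step y i j := by
    intro y
    simp only [weight, push, Matrix.vecMul, dotProduct]
    rw [Finset.sum_comm]
    simp only [Finset.mul_sum]
    rfl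
  simp only [h2]
  rw [Finset.sum_comm]
  simp only [← Finset.mul_sum, h1, mul_one]
  exact α.2.2

open scoped Classical in
/-- The updated state `α M(y) / α M(y) e`. If `α M(y) e = 0` the value is irrelevant (it is
always multiplied by the weight `α M(y) e = 0`) and is set to `α`. -/
noncomputable def next (H : SteppingFamily X Y) (y : Y) (α : stdSimplex ℝ X) : stdSimplex ℝ X :=
  if h : H.weight y α = 0 then α
  else ⟨fun j => H.push y α j / H.weight y α,
    fun j => div_nonneg (H.push_nonneg y α j) (H.weight_nonneg y α), by
      rw [← Finset.sum_div]; exact div_self h⟩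

theorem continuous_push (H : SteppingFamily X Y) (y : Y) : Continuous (H.push y) := by
  unfold push
  exact Continuous.matrix_vecMul continuous_subtype_val continuous_const

theorem continuous_weight (H : SteppingFamily X Y) (y : Y) : Continuous (H.weight y) :=
  continuous_finsetSum _ fun j _ => (continuous_apply j).comp (H.continuous_push y)

theorem measurable_next (H : SteppingFamily X Y) (y : Y) : Measurable (H.next y) := by
  classical
  have hw := (H.continuous_weight y).measurable
  refine Measurable.subtype_mk (f := fun α => (H.next y α).1) ?_ (h := fun α => (H.next y α).2)
  have : (fun α => (H.next y α).1) = fun α : stdSimplex ℝ X =>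
      if H.weight y α = 0 then α.1 else fun j => H.push y α j / H.weight y α := by
    funext α
    unfold next
    split_ifs <;> rfl
  rw [this]
  refine Measurable.ite (hw (measurableSet_singleton 0)) measurable_subtype_coe ?_
  refine measurable_pi_lambda _ fun j => ?_
  exact ((measurable_pi_apply j).comp (H.continuous_push y).measurable).div hw

/-- The transition kernel of the `α`-chain,
`P(α, A) = ∑ α M(y) e` over those `y` for which `α M(y) / α M(y) e ∈ A`. -/
noncomputable def kernel (H : SteppingFamily X Y) : Kernel (stdSimplex ℝ X) (stdSimplex ℝ X) where
  toFun α := ∑ y, ENNReal.ofReal (H.weight y α) • Measure.dirac (H.next y α)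
  measurable' := by
    refine Measure.measurable_of_measurable_coe _ fun s hs => ?_
    simp only [Measure.coe_finsetSum, Finset.sum_apply, Measure.smul_apply, smul_eq_mul]
    refine Finset.measurable_sum _ fun y _ => ?_
    refine (H.continuous_weight y).measurable.ennreal_ofReal.mul ?_
    exact (Measure.measurable_coe hs).comp (Measure.measurable_dirac.comp (H.measurable_next y))

theorem kernel_apply (H : SteppingFamily X Y) (α : stdSimplex ℝ X) :
    H.kernel α = ∑ y, ENNReal.ofReal (H.weight y α) • Measure.dirac (H.next y α) := rfl

instance (H : SteppingFamily X Y) : IsMarkovKernel H.kernel where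
  isProbabilityMeasure α := ⟨by
    simp only [kernel_apply, Measure.coe_finsetSum, Finset.sum_apply, Measure.smul_apply,
      smul_eq_mul, measure_univ, mul_one]
    rw [← ENNReal.ofReal_sum_of_nonneg fun y _ => H.weight_nonneg y α, H.sum_weight,
      ENNReal.ofReal_one]⟩

/-- The Markov operator `T` of the `α`-chain on continuous functions,
`(T f)(α) = ∑ y, (α M(y) e) f(α M(y) / α M(y) e)`. -/
noncomputable def markovOp (H : SteppingFamily X Y) (f : C(stdSimplex ℝ X, ℝ)) :
    C(stdSimplex ℝ X, ℝ) where
  toFun α := ∑ y, H.weight y α * f (H.next y α)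
  continuous_toFun := by
    refine continuous_finsetSum _ fun y _ => continuous_iff_continuousAt.2 fun a => ?_
    by_cases h : H.weight y a = 0
    · have hw : Tendsto (H.weight y) (𝓝 a) (𝓝 0) := h ▸ (H.continuous_weight y).tendsto a
      have : Tendsto (fun α => H.weight y α * f (H.next y α)) (𝓝 a) (𝓝 0) := by
        refine squeeze_zero_norm (a := fun α => H.weight y α * ‖f‖) (fun α => ?_) ?_
        · rw [norm_mul, Real.norm_of_nonneg (H.weight_nonneg y α)]
          exact mul_le_mul_of_nonneg_left (f.norm_coe_le_norm _) (H.weight_nonneg y α)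
        · simpa using hw.mul_const ‖f‖
      simpa [ContinuousAt, h] using this
    · have hev : ∀ᶠ α in 𝓝 a, H.weight y α ≠ 0 :=
        (H.continuous_weight y).continuousAt.eventually_ne h
      refine (H.continuous_weight y).continuousAt.mul (f.continuous.continuousAt.comp ?_)
      rw [ContinuousAt, tendsto_subtype_rng]
      have key : ∀ α, H.weight y α ≠ 0 →
          (H.next y α).1 = fun j => H.push y α j / H.weight y α := by
        intro α hα
        simp [next, hα]
      rw [key a h]
      refine Tendsto.congr' (hev.mono fun α hα => (key α hα).symm) ?_
      refine tendsto_pi_nhds.2 fun j => ?_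
      exact (((continuous_apply j).comp (H.continuous_push y)).tendsto a).div
        ((H.continuous_weight y).tendsto a) h

/-- The action `T*` of the `α`-chain on probability measures on the simplex: if `μ` is the law of
`α₀` then `T* μ` is the law of `α₁`. -/
noncomputable def dualOp (H : SteppingFamily X Y) (μ : ProbabilityMeasure (stdSimplex ℝ X)) :
    ProbabilityMeasure (stdSimplex ℝ X) :=
  ⟨(μ : Measure (stdSimplex ℝ X)).bind H.kernel, inferInstance⟩

/-- `T*` is the adjoint of `T`. -/
theorem integral_dualOp (H : SteppingFamily X Y) (μ : ProbabilityMeasure (stdSimplex ℝ X))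
    (f : C(stdSimplex ℝ X, ℝ)) :
    ∫ α, f α ∂(H.dualOp μ : Measure (stdSimplex ℝ X)) =
      ∫ α, H.markovOp f α ∂(μ : Measure (stdSimplex ℝ X)) := by
  have hf : Integrable f (H.dualOp μ : Measure (stdSimplex ℝ X)) :=
    (BoundedContinuousFunction.mkOfCompact f).integrable _
  have hbind : (H.dualOp μ : Measure (stdSimplex ℝ X)) =
      (H.kernel ∘ₖ Kernel.const Unit (μ : Measure (stdSimplex ℝ X))) () :=
    Measure.comp_eq_comp_const_apply
  rw [hbind] at hf ⊢
  rw [Kernel.integral_comp hf, Kernel.const_apply]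
  congr 1
  funext α
  rw [kernel_apply, integral_finsetSum_measure]
  · simp only [integral_smul_measure, integral_dirac, smul_eq_mul,
      ENNReal.toReal_ofReal (H.weight_nonneg _ α)]
    rfl
  · intro y _
    exact ((BoundedContinuousFunction.mkOfCompact f).integrable _).smul_measure
      ENNReal.ofReal_ne_top

/-- A probability measure `μ` on the simplex is `T`-invariant if `∫ T f dμ = ∫ f dμ` for every
continuous `f`. -/
def IsInvariant (H : SteppingFamily X Y) (μ : ProbabilityMeasure (stdSimplex ℝ X)) : Prop :=
  ∀ f : C(stdSimplex ℝ X, ℝ), ∫ α, H.markovOp f α ∂(μ : Measure (stdSimplex ℝ X)) =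
    ∫ α, f α ∂(μ : Measure (stdSimplex ℝ X))

/-- Invariance is the same as being a fixed point of `T*`. -/
theorem isInvariant_iff (H : SteppingFamily X Y) (μ : ProbabilityMeasure (stdSimplex ℝ X)) :
    H.IsInvariant μ ↔ H.dualOp μ = μ := by
  constructor
  · intro h
    apply Subtype.ext
    have h1 : IsProbabilityMeasure (H.dualOp μ).1 := (H.dualOp μ).2
    have h2 : IsProbabilityMeasure μ.1 := μ.2
    refine ext_of_forall_integral_eq_of_IsFiniteMeasure fun f => ?_
    exact (H.integral_dualOp μ f.toContinuousMap).trans (h f.toContinuousMap)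
  · intro h f
    rw [← H.integral_dualOp μ f, h]

end SteppingFamily

section Matrix

open Matrix

variable {X : Type*} [Fintype X]

/-- The rows of a subrectangular nonnegative matrix are either zero or comparable to a given
nonzero row. -/
theorem IsSubrectangular.exists_comparable {D : Matrix X X ℝ} (hD : IsSubrectangular D)
    (h0 : ∀ i j, 0 ≤ D i j) {r s : X} (hr : 0 < D r s) :
    ∃ δ > 0, ∀ i, (∀ j, D i j = 0) ∨ ∀ j, δ * D r j ≤ D i j ∧ δ * D i j ≤ D r j := by
  obtain ⟨R, C, hRC⟩ := hD
  have hrR := ((hRC r s).1 hr).1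
  have small : ∀ a b : ℝ, (0 < b ∨ a = 0 ∧ b = 0) → ∀ᶠ δ in 𝓝[>] (0 : ℝ), δ * a ≤ b := by
    rintro a b (hb | ⟨rfl, rfl⟩)
    · have : Tendsto (fun δ : ℝ => δ * a) (𝓝[>] 0) (𝓝 0) := by
        have : Tendsto (fun δ : ℝ => δ * a) (𝓝 0) (𝓝 (0 * a)) :=
          (continuous_id.mul continuous_const).tendsto 0
        rw [zero_mul] at this
        exact this.mono_left nhdsWithin_le_nhds
      exact (this.eventually_lt_const hb).mono fun _ h => h.le
    · simp
  have hzero : ∀ i j, ¬ (i ∈ R ∧ j ∈ C) → D i j = 0 := fun i j h =>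
    le_antisymm (not_lt.1 fun h' => h ((hRC i j).1 h')) (h0 i j)
  have key : ∀ i ∈ R, ∀ k ∈ R, ∀ j, 0 < D i j ∨ D k j = 0 ∧ D i j = 0 := by
    intro i hi k _ j
    by_cases hj : j ∈ C
    · exact Or.inl ((hRC i j).2 ⟨hi, hj⟩)
    · exact Or.inr ⟨hzero _ _ fun h => hj h.2, hzero _ _ fun h => hj h.2⟩
  have hev : ∀ᶠ δ in 𝓝[>] (0 : ℝ), ∀ i j, i ∈ R → δ * D r j ≤ D i j ∧ δ * D i j ≤ D r j := by
    refine eventually_all.2 fun i => eventually_all.2 fun j => ?_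
    by_cases hi : i ∈ R
    · filter_upwards [small _ _ (key i hi r hrR j), small _ _ (key r hrR i hi j)] with δ h1 h2 _
      exact ⟨h1, h2⟩
    · exact Eventually.of_forall fun δ h => absurd h hi
  obtain ⟨δ, hδ, hpos⟩ := (hev.and self_mem_nhdsWithin).exists
  refine ⟨δ, hpos, fun i => ?_⟩
  by_cases hi : i ∈ R
  · exact Or.inr fun j => hδ i j hi
  · exact Or.inl fun j => hzero _ _ fun h => hi h.1

/-- If the rows of `D` are either zero or comparable to the row `r`, then `D` contracts the
oscillation of the ratio of two vectors. -/
theorem exists_mulVec_bounds {D : Matrix X X ℝ} (hD : ∀ i j, 0 ≤ D i j) {r : X} {δ : ℝ}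
    (hδ : 0 < δ)
    (hcomp : ∀ i, (∀ j, D i j = 0) ∨ ∀ j, δ * D r j ≤ D i j ∧ δ * D i j ≤ D r j)
    {a h : X → ℝ} {lo hi : ℝ} (hlo : ∀ i, lo * h i ≤ a i) (hhi : ∀ i, a i ≤ hi * h i)
    (h0 : ∀ i, 0 ≤ h i) (hr : 0 < (D *ᵥ h) r) :
    ∃ lo' hi' : ℝ, hi' - lo' = (1 - δ ^ 2) * (hi - lo) ∧
      ∀ i, lo' * (D *ᵥ h) i ≤ (D *ᵥ a) i ∧ (D *ᵥ a) i ≤ hi' * (D *ᵥ h) i := by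
  set p : X → ℝ := fun i => a i - lo * h i with hp
  set q : X → ℝ := fun i => hi * h i - a i with hq
  have ep : D *ᵥ p = fun i => (D *ᵥ a) i - lo * (D *ᵥ h) i := by
    funext i
    simp only [hp, mulVec, dotProduct, Finset.mul_sum, ← Finset.sum_sub_distrib]
    exact Finset.sum_congr rfl fun j _ => by ring
  have eq : D *ᵥ q = fun i => hi * (D *ᵥ h) i - (D *ᵥ a) i := by
    funext i
    simp only [hq, mulVec, dotProduct, Finset.mul_sum, ← Finset.sum_sub_distrib]
    exact Finset.sum_congr rfl fun j _ => by ring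
  have comp : ∀ b : X → ℝ, (∀ j, 0 ≤ b j) → ∀ i, (∀ j, δ * D r j ≤ D i j ∧ δ * D i j ≤ D r j) →
      δ * (D *ᵥ b) r ≤ (D *ᵥ b) i ∧ δ * (D *ᵥ b) i ≤ (D *ᵥ b) r := by
    intro b hb i hi
    simp only [mulVec, dotProduct, Finset.mul_sum, ← mul_assoc]
    exact ⟨Finset.sum_le_sum fun j _ => mul_le_mul_of_nonneg_right (hi j).1 (hb j),
      Finset.sum_le_sum fun j _ => mul_le_mul_of_nonneg_right (hi j).2 (hb j)⟩
  have main : ∀ b : X → ℝ, (∀ j, 0 ≤ b j) → (0 ≤ (D *ᵥ b) r) →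
      ∀ i, δ ^ 2 * ((D *ᵥ b) r / (D *ᵥ h) r) * (D *ᵥ h) i ≤ (D *ᵥ b) i := by
    intro b hb hbr i
    rcases hcomp i with hi | hi
    · simp [mulVec, dotProduct, hi]
    · calc δ ^ 2 * ((D *ᵥ b) r / (D *ᵥ h) r) * (D *ᵥ h) i
          = δ * ((D *ᵥ b) r / (D *ᵥ h) r) * (δ * (D *ᵥ h) i) := by ring
        _ ≤ δ * ((D *ᵥ b) r / (D *ᵥ h) r) * (D *ᵥ h) r :=
            mul_le_mul_of_nonneg_left (comp h h0 i hi).2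
              (mul_nonneg hδ.le (div_nonneg hbr hr.le))
        _ = δ * (D *ᵥ b) r := by field_simp
        _ ≤ (D *ᵥ b) i := (comp b hb i hi).1
  have nonneg_r : ∀ b : X → ℝ, (∀ j, 0 ≤ b j) → 0 ≤ (D *ᵥ b) r := fun b hb =>
    Finset.sum_nonneg fun j _ => mul_nonneg (hD r j) (hb j)
  have hp0 : ∀ j, 0 ≤ p j := fun j => sub_nonneg.2 (hlo j)
  have hq0 : ∀ j, 0 ≤ q j := fun j => sub_nonneg.2 (hhi j)
  have hpm := main p hp0 (nonneg_r p hp0)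
  have hqm := main q hq0 (nonneg_r q hq0)
  rw [ep] at hpm
  rw [eq] at hqm
  refine ⟨lo + δ ^ 2 * (((D *ᵥ a) r - lo * (D *ᵥ h) r) / (D *ᵥ h) r),
    hi - δ ^ 2 * ((hi * (D *ᵥ h) r - (D *ᵥ a) r) / (D *ᵥ h) r), ?_, fun i => ?_⟩
  · field_simp
    ring
  · have := hpm i
    have := hqm i
    constructor <;> linarith

theorem exists_pos_of_mul_apply_pos {A B : Matrix X X ℝ} (hA : ∀ i j, 0 ≤ A i j)
    (hB : ∀ i j, 0 ≤ B i j) {i j : X} (h : 0 < (A * B) i j) : ∃ k, 0 < A i k ∧ 0 < B k j := by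
  rw [mul_apply] at h
  obtain ⟨k, -, hk⟩ := Finset.exists_ne_zero_of_sum_ne_zero h.ne'
  exact ⟨k, (hA i k).lt_of_ne' (left_ne_zero_of_mul hk),
    (hB k j).lt_of_ne' (right_ne_zero_of_mul hk)⟩

theorem IsSubrectangular.mul {A B : Matrix X X ℝ} (hsub : IsSubrectangular A)
    (hA : ∀ i j, 0 ≤ A i j) (hB : ∀ i j, 0 ≤ B i j) : IsSubrectangular (A * B) := by
  obtain ⟨R, C, hRC⟩ := hsub
  refine ⟨R, {j | ∃ k ∈ C, 0 < B k j}, fun i j => ?_⟩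
  constructor
  · intro h
    obtain ⟨k, hAk, hBk⟩ := exists_pos_of_mul_apply_pos hA hB h
    exact ⟨((hRC i k).1 hAk).1, k, ((hRC i k).1 hAk).2, hBk⟩
  · rintro ⟨hi, k, hk, hkj⟩
    rw [mul_apply]
    exact Finset.sum_pos' (fun l _ => mul_nonneg (hA i l) (hB l j))
      ⟨k, Finset.mem_univ k, mul_pos ((hRC i k).2 ⟨hi, hk⟩) hkj⟩

variable [DecidableEq X]

theorem pow_nonneg_apply {D : Matrix X X ℝ} (hD : ∀ i j, 0 ≤ D i j) (n : ℕ) (i j : X) :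
    0 ≤ (D ^ n) i j := by
  induction n generalizing i j with
  | zero => rw [pow_zero, one_apply]; split_ifs <;> norm_num
  | succ n ih =>
    rw [pow_succ, mul_apply]
    exact Finset.sum_nonneg fun k _ => mul_nonneg (ih i k) (hD k j)

theorem pow_diag_pos {D : Matrix X X ℝ} (hD : ∀ i j, 0 ≤ D i j) {r : X} (hr : 0 < D r r)
    (n : ℕ) : 0 < (D ^ n) r r := by
  induction n with
  | zero => simp
  | succ n ih =>
    rw [pow_succ, mul_apply]
    exact Finset.sum_pos' (fun k _ => mul_nonneg (pow_nonneg_apply hD n r k) (hD k r))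
      ⟨r, Finset.mem_univ r, mul_pos ih hr⟩

/-- The normalized rows of the powers of `D` merge geometrically. -/
theorem exists_pow_mulVec_bounds {D : Matrix X X ℝ} (hD : ∀ i j, 0 ≤ D i j) {r : X}
    (hr : 0 < D r r) {δ : ℝ} (hδ : 0 < δ)
    (hcomp : ∀ i, (∀ j, D i j = 0) ∨ ∀ j, δ * D r j ≤ D i j ∧ δ * D i j ≤ D r j)
    (j : X) (n : ℕ) :
    ∃ lo hi : ℝ, hi - lo = (1 - δ ^ 2) ^ n ∧
      ∀ i, lo * ∑ k, (D ^ n) i k ≤ (D ^ n) i j ∧ (D ^ n) i j ≤ hi * ∑ k, (D ^ n) i k := by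
  induction n with
  | zero =>
    refine ⟨0, 1, by simp, fun i => ?_⟩
    rw [pow_zero, one_apply]
    have : ∑ k, (1 : Matrix X X ℝ) i k = 1 := by simp [one_apply]
    rw [this]
    split_ifs <;> norm_num
  | succ n ih =>
    obtain ⟨lo, hi, hd, hb⟩ := ih
    have e1 : ∀ i, (D *ᵥ fun i => ∑ k, (D ^ n) i k) i = ∑ k, (D ^ (n + 1)) i k := by
      intro i
      simp only [pow_succ', mul_apply, mulVec, dotProduct, Finset.mul_sum]
      exact Finset.sum_comm
    have e2 : ∀ i, (D *ᵥ fun i => (D ^ n) i j) i = (D ^ (n + 1)) i j := by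
      intro i
      simp only [pow_succ', mul_apply, mulVec, dotProduct]
    obtain ⟨lo', hi', hd', hb'⟩ := exists_mulVec_bounds hD hδ hcomp
      (a := fun i => (D ^ n) i j) (h := fun i => ∑ k, (D ^ n) i k)
      (fun i => (hb i).1) (fun i => (hb i).2)
      (fun i => Finset.sum_nonneg fun k _ => pow_nonneg_apply hD n i k)
      (by
        rw [e1]
        exact Finset.sum_pos' (fun k _ => pow_nonneg_apply hD _ r k)
          ⟨r, Finset.mem_univ r, pow_diag_pos hD hr _⟩)
    refine ⟨lo', hi', by rw [hd', hd]; ring, fun i => ?_⟩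
    rw [← e1, ← e2]
    exact hb' i

/-- High powers of a nonnegative subrectangular matrix with a positive diagonal entry map all
nonnegative vectors to almost the same direction. -/
theorem IsSubrectangular.exists_pow_merge {D : Matrix X X ℝ} (hsub : IsSubrectangular D)
    (hD : ∀ i j, 0 ≤ D i j) {r : X} (hr : 0 < D r r) {ε : ℝ} (hε : 0 < ε) :
    ∃ n : ℕ, ∀ (v v' : X → ℝ) (c c' : ℝ) (γ γ' : stdSimplex ℝ X),
      (∀ i, 0 ≤ v i) → (∀ i, 0 ≤ v' i) → 0 < c → 0 < c' →
      v ᵥ* D ^ n = c • γ.1 → v' ᵥ* D ^ n = c' • γ'.1 → ∑ j, |γ.1 j - γ'.1 j| ≤ ε := by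
  obtain ⟨δ, hδ, hcomp⟩ := hsub.exists_comparable hD hr
  have hδ1 : δ ≤ 1 := by
    rcases hcomp r with h | h
    · exact absurd (h r) hr.ne'
    · have := (h r).1
      by_contra! hlt
      nlinarith
  have hcard : 0 < (Fintype.card X : ℝ) := Nat.cast_pos.2 (Fintype.card_pos_iff.2 ⟨r⟩)
  obtain ⟨n, hn⟩ := exists_pow_lt_of_lt_one (div_pos hε hcard)
    (show 1 - δ ^ 2 < 1 by have := pow_pos hδ 2; linarith)
  have hbound : ∀ j, ∃ lo hi : ℝ, hi - lo = (1 - δ ^ 2) ^ n ∧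
      ∀ (v : X → ℝ) (c : ℝ) (γ : stdSimplex ℝ X), (∀ i, 0 ≤ v i) → 0 < c →
        v ᵥ* D ^ n = c • γ.1 → lo ≤ γ.1 j ∧ γ.1 j ≤ hi := by
    intro j
    obtain ⟨lo, hi, hd, hb⟩ := exists_pow_mulVec_bounds hD hr hδ hcomp j n
    refine ⟨lo, hi, hd, fun v c γ hv hc hγ => ?_⟩
    have hj : ∑ i, v i * (D ^ n) i j = c * γ.1 j := by
      simpa [vecMul, dotProduct] using congrFun hγ j
    have hs : ∑ i, v i * ∑ k, (D ^ n) i k = c := by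
      have h1 : ∑ k, (v ᵥ* D ^ n) k = c := by
        rw [hγ]
        simp only [Pi.smul_apply, smul_eq_mul, ← Finset.mul_sum]
        rw [γ.2.2, mul_one]
      rw [← h1]
      simp only [vecMul, dotProduct, Finset.mul_sum]
      exact Finset.sum_comm
    have h1 : lo * c ≤ c * γ.1 j := by
      rw [← hj, ← hs, Finset.mul_sum]
      refine Finset.sum_le_sum fun i _ => ?_
      have := mul_le_mul_of_nonneg_left (hb i).1 (hv i)
      linarith
    have h2 : c * γ.1 j ≤ hi * c := by
      rw [← hj, ← hs, Finset.mul_sum]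
      refine Finset.sum_le_sum fun i _ => ?_
      have := mul_le_mul_of_nonneg_left (hb i).2 (hv i)
      linarith
    constructor
    · exact le_of_mul_le_mul_left (by linarith) hc
    · exact le_of_mul_le_mul_left (by linarith) hc
  refine ⟨n, fun v v' c c' γ γ' hv hv' hc hc' hγ hγ' => ?_⟩
  calc ∑ j, |γ.1 j - γ'.1 j| ≤ ∑ _j : X, ε / Fintype.card X := by
        refine Finset.sum_le_sum fun j _ => ?_
        obtain ⟨lo, hi, hd, hb⟩ := hbound j
        have h1 := hb v c γ hv hc hγ
        have h2 := hb v' c' γ' hv' hc' hγ'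
        rw [abs_le]
        constructor <;> linarith [h1.1, h1.2, h2.1, h2.2]
    _ = ε := by
        rw [Finset.sum_const, Finset.card_univ, nsmul_eq_mul]
        field_simp

end Matrix

theorem exists_eq_smul_stdSimplex {X : Type*} [Fintype X] [Nonempty X] {v : X → ℝ}
    (hv : ∀ i, 0 ≤ v i) : ∃ γ : stdSimplex ℝ X, v = (∑ i, v i) • γ.1 := by
  rcases (Finset.sum_nonneg fun i _ => hv i).eq_or_lt' with h | h
  · obtain ⟨γ⟩ : Nonempty (stdSimplex ℝ X) := inferInstance
    refine ⟨γ, ?_⟩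
    rw [h, zero_smul]
    funext i
    exact (Finset.sum_eq_zero_iff_of_nonneg fun i _ => hv i).1 h i (Finset.mem_univ i)
  · refine ⟨⟨fun i => v i / ∑ k, v k, fun i => div_nonneg (hv i) h.le, ?_⟩, ?_⟩
    · rw [← Finset.sum_div, div_self h.ne']
    · funext i
      simp only [Pi.smul_apply, smul_eq_mul]
      field_simp

namespace SteppingFamily

open Matrix

variable {X Y : Type*} [Fintype X] [Fintype Y] (H : SteppingFamily X Y)

section Words

variable [DecidableEq X]

theorem word_cons (y : Y) (w : List Y) : H.word (y :: w) = H.step y * H.word w := by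
  simp [word]

theorem word_append (v w : List Y) : H.word (v ++ w) = H.word v * H.word w := by
  simp [word]

theorem word_flatten_replicate (w : List Y) (n : ℕ) :
    H.word (List.replicate n w).flatten = H.word w ^ n := by
  induction n with
  | zero => simp [word]
  | succ n ih => rw [List.replicate_succ, List.flatten_cons, word_append, ih, pow_succ']

theorem word_nonneg (w : List Y) (i j : X) : 0 ≤ H.word w i j := by
  induction w generalizing i j with
  | nil => rw [word, List.map_nil, List.prod_nil, one_apply]; split_ifs <;> norm_num
  | cons y w ih =>
    rw [word_cons, mul_apply]
    exact Finset.sum_nonneg fun k _ => mul_nonneg (H.nonneg y i k) (ih k j)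

theorem exists_word_pos {k : ℕ} {i j : X} (h : 0 < (H.transition ^ k) i j) :
    ∃ w : List Y, w.length = k ∧ 0 < H.word w i j := by
  have hT : ∀ i j, 0 ≤ H.transition i j := fun i j => by
    rw [transition, Matrix.sum_apply]
    exact Finset.sum_nonneg fun y _ => H.nonneg y i j
  induction k generalizing i with
  | zero => exact ⟨[], rfl, by simpa [word] using h⟩
  | succ k ih =>
    rw [pow_succ'] at h
    obtain ⟨l, h1, h2⟩ := exists_pos_of_mul_apply_pos hT (pow_nonneg_apply hT k) h
    obtain ⟨w, hw, hpos⟩ := ih h2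
    rw [transition, Matrix.sum_apply] at h1
    obtain ⟨y, -, hy⟩ := Finset.exists_ne_zero_of_sum_ne_zero h1.ne'
    refine ⟨y :: w, by simp [hw], ?_⟩
    rw [word_cons, mul_apply]
    exact Finset.sum_pos' (fun m _ => mul_nonneg (H.nonneg y i m) (H.word_nonneg w m j))
      ⟨l, Finset.mem_univ l, mul_pos ((H.nonneg y i l).lt_of_ne' hy) hpos⟩

theorem exists_subrectangular_diag_pos (haper : H.transition.IsPrimitive)
    (hsub : ∃ y : List Y, H.word y ≠ 0 ∧ IsSubrectangular (H.word y)) :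
    ∃ (w : List Y) (r : X), IsSubrectangular (H.word w) ∧ 0 < H.word w r r := by
  obtain ⟨-, k, -, hk⟩ := haper
  obtain ⟨y, hy0, hy⟩ := hsub
  obtain ⟨r, c, hrc⟩ : ∃ r c, H.word y r c ≠ 0 := by
    by_contra! h
    exact hy0 (Matrix.ext h)
  obtain ⟨z, -, hz⟩ := H.exists_word_pos (hk c r)
  refine ⟨y ++ z, r, ?_, ?_⟩
  · rw [word_append]
    exact hy.mul (H.word_nonneg y) (H.word_nonneg z)
  · rw [word_append, mul_apply]
    exact Finset.sum_pos' (fun l _ => mul_nonneg (H.word_nonneg y r l) (H.word_nonneg z l r))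
      ⟨c, Finset.mem_univ c, mul_pos ((H.word_nonneg y r c).lt_of_ne' hrc) hz⟩

/-- Any two states can be steered, by words of the same length and with probability bounded from
below, to states that are arbitrarily close. -/
theorem exists_merging_words (haper : H.transition.IsPrimitive)
    (hsub : ∃ y : List Y, H.word y ≠ 0 ∧ IsSubrectangular (H.word y)) {ε : ℝ} (hε : 0 < ε) :
    ∃ (m : ℕ) (p : ℝ), 0 < p ∧ ∀ α β : stdSimplex ℝ X, ∃ (x x' : List Y) (c c' : ℝ)
      (γ γ' : stdSimplex ℝ X), x.length = m ∧ x'.length = m ∧ p ≤ c ∧ p ≤ c' ∧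
        α.1 ᵥ* H.word x = c • γ.1 ∧ β.1 ᵥ* H.word x' = c' • γ'.1 ∧
        ∑ j, |γ.1 j - γ'.1 j| ≤ ε := by
  obtain ⟨w, r, hw, hr⟩ := H.exists_subrectangular_diag_pos haper hsub
  obtain ⟨-, k, -, hk⟩ := haper
  obtain ⟨n, hn⟩ := hw.exists_pow_merge (H.word_nonneg w) hr hε
  have : Nonempty X := ⟨r⟩
  choose x hxlen hxpos using fun i => H.exists_word_pos (hk i r)
  obtain ⟨i₀, hi₀⟩ := Finite.exists_min fun i => H.word (x i) i r
  have hcard : 0 < (Fintype.card X : ℝ) := Nat.cast_pos.2 Fintype.card_pos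
  set p : ℝ := 1 / Fintype.card X * H.word (x i₀) i₀ r * (H.word w ^ n) r r with hp
  have hD := pow_nonneg_apply (H.word_nonneg w) n
  have hDr := pow_diag_pos (H.word_nonneg w) hr n
  have hp0 : 0 < p := mul_pos (mul_pos (one_div_pos.2 hcard) (hxpos i₀)) hDr
  have key : ∀ α : stdSimplex ℝ X, ∃ i, ∃ c, ∃ γ : stdSimplex ℝ X, p ≤ c ∧
      α.1 ᵥ* H.word (x i) ᵥ* H.word w ^ n = c • γ.1 := by
    intro α
    obtain ⟨i, hi⟩ : ∃ i, 1 / (Fintype.card X : ℝ) ≤ α.1 i := by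
      by_contra! h
      have h1 : ∑ i, α.1 i < ∑ _i : X, 1 / (Fintype.card X : ℝ) :=
        Finset.sum_lt_sum_of_nonempty Finset.univ_nonempty fun i _ => h i
      rw [α.2.2, Finset.sum_const, Finset.card_univ, nsmul_eq_mul,
        mul_one_div_cancel hcard.ne'] at h1
      exact lt_irrefl _ h1
    have hu : ∀ j, 0 ≤ (α.1 ᵥ* H.word (x i)) j := fun j =>
      Finset.sum_nonneg fun l _ => mul_nonneg (α.2.1 l) (H.word_nonneg _ l j)
    have hv : ∀ j, 0 ≤ (α.1 ᵥ* H.word (x i) ᵥ* H.word w ^ n) j := fun j =>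
      Finset.sum_nonneg fun l _ => mul_nonneg (hu l) (hD l j)
    obtain ⟨γ, hγ⟩ := exists_eq_smul_stdSimplex hv
    refine ⟨i, _, γ, ?_, hγ⟩
    calc p ≤ α.1 i * H.word (x i) i r * (H.word w ^ n) r r :=
          mul_le_mul_of_nonneg_right (mul_le_mul hi (hi₀ i) (hxpos i₀).le (α.2.1 i)) hDr.le
      _ ≤ (α.1 ᵥ* H.word (x i)) r * (H.word w ^ n) r r := by
          refine mul_le_mul_of_nonneg_right ?_ hDr.le
          exact Finset.single_le_sum (f := fun l => α.1 l * H.word (x i) l r)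
            (fun l _ => mul_nonneg (α.2.1 l) (H.word_nonneg _ l r)) (Finset.mem_univ i)
      _ ≤ (α.1 ᵥ* H.word (x i) ᵥ* H.word w ^ n) r :=
          Finset.single_le_sum (f := fun l => (α.1 ᵥ* H.word (x i)) l * (H.word w ^ n) l r)
            (fun l _ => mul_nonneg (hu l) (hD l r)) (Finset.mem_univ r)
      _ ≤ ∑ j, (α.1 ᵥ* H.word (x i) ᵥ* H.word w ^ n) j :=
          Finset.single_le_sum (fun l _ => hv l) (Finset.mem_univ r)
  refine ⟨k + (List.replicate n w).flatten.length, p, hp0, fun α β => ?_⟩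
  obtain ⟨i, c, γ, hc, hγ⟩ := key α
  obtain ⟨i', c', γ', hc', hγ'⟩ := key β
  refine ⟨x i ++ (List.replicate n w).flatten, x i' ++ (List.replicate n w).flatten, c, c', γ, γ',
    by rw [List.length_append, hxlen], by rw [List.length_append, hxlen], hc, hc', ?_, ?_, ?_⟩
  · rw [word_append, word_flatten_replicate, ← vecMul_vecMul, hγ]
  · rw [word_append, word_flatten_replicate, ← vecMul_vecMul, hγ']
  · exact hn _ _ c c' γ γ'
      (fun j => Finset.sum_nonneg fun l _ => mul_nonneg (α.2.1 l) (H.word_nonneg _ l j))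
      (fun j => Finset.sum_nonneg fun l _ => mul_nonneg (β.2.1 l) (H.word_nonneg _ l j))
      (hp0.trans_le hc) (hp0.trans_le hc') hγ hγ'

end Words

section Operator

theorem markovOp_apply (f : C(stdSimplex ℝ X, ℝ)) (α : stdSimplex ℝ X) :
    H.markovOp f α = ∑ y, H.weight y α * f (H.next y α) := rfl

theorem push_eq_weight_smul_next (y : Y) (α : stdSimplex ℝ X) :
    H.push y α = H.weight y α • (H.next y α).1 := by
  funext j
  by_cases h : H.weight y α = 0
  · rw [h, zero_smul]
    exact (Finset.sum_eq_zero_iff_of_nonneg fun i _ => H.push_nonneg y α i).1 h j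
      (Finset.mem_univ j)
  · simp only [next, h, dite_false, Pi.smul_apply, smul_eq_mul]
    field_simp

theorem weight_mul_next (y : Y) (α : stdSimplex ℝ X) (j : X) :
    H.weight y α * (H.next y α).1 j = ∑ i, α.1 i * H.step y i j :=
  (congrFun (H.push_eq_weight_smul_next y α) j).symm

theorem sum_sum_step (i : X) : ∑ y, ∑ j, H.step y i j = 1 := by
  rw [Finset.sum_comm, ← H.row_sum i]
  simp [Matrix.sum_apply]

theorem markovOp_const (a : ℝ) :
    H.markovOp (ContinuousMap.const _ a) = ContinuousMap.const _ a := by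
  ext α
  simp [markovOp_apply, ← Finset.sum_mul, H.sum_weight]

theorem markovOp_sub (f g : C(stdSimplex ℝ X, ℝ)) :
    H.markovOp (f - g) = H.markovOp f - H.markovOp g := by
  ext α
  simp [markovOp_apply, mul_sub]

theorem markovOp_mono {f g : C(stdSimplex ℝ X, ℝ)} (h : f ≤ g) : H.markovOp f ≤ H.markovOp g :=
  fun α => Finset.sum_le_sum fun y _ => mul_le_mul_of_nonneg_left (h _) (H.weight_nonneg y α)

theorem iterate_markovOp_const (a : ℝ) (n : ℕ) :
    H.markovOp^[n] (ContinuousMap.const _ a) = ContinuousMap.const _ a :=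
  Function.iterate_fixed (H.markovOp_const a) n

theorem iterate_markovOp_sub (f g : C(stdSimplex ℝ X, ℝ)) (n : ℕ) :
    H.markovOp^[n] (f - g) = H.markovOp^[n] f - H.markovOp^[n] g := by
  induction n with
  | zero => rfl
  | succ n ih => simp only [Function.iterate_succ_apply', ih, markovOp_sub]

theorem iterate_markovOp_mono {f g : C(stdSimplex ℝ X, ℝ)} (h : f ≤ g) (n : ℕ) :
    H.markovOp^[n] f ≤ H.markovOp^[n] g := by
  induction n with
  | zero => exact h
  | succ n ih => simpa only [Function.iterate_succ_apply'] using H.markovOp_mono ih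

theorem iterate_markovOp_nonneg {g : C(stdSimplex ℝ X, ℝ)} (h : 0 ≤ g) (n : ℕ) :
    0 ≤ H.markovOp^[n] g := by
  have := H.iterate_markovOp_mono h n
  rwa [show (0 : C(stdSimplex ℝ X, ℝ)) = ContinuousMap.const _ 0 from rfl,
    iterate_markovOp_const] at this

/-- A single word of length `n` already contributes to the `n`-th iterate of `T`. -/
theorem mul_le_iterate_markovOp [DecidableEq X] {g : C(stdSimplex ℝ X, ℝ)} (hg : 0 ≤ g)
    (w : List Y) {α γ : stdSimplex ℝ X} {c : ℝ} (h : α.1 ᵥ* H.word w = c • γ.1) :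
    c * g γ ≤ H.markovOp^[w.length] g α := by
  have total : ∀ {v : X → ℝ} {c : ℝ}, v = c • γ.1 → ∑ j, v j = c := by
    rintro v c rfl
    simp only [Pi.smul_apply, smul_eq_mul, ← Finset.mul_sum]
    rw [γ.2.2, mul_one]
  induction w generalizing α c with
  | nil =>
    simp only [word, List.map_nil, List.prod_nil, vecMul_one] at h
    have hc : c = 1 := by rw [← total h]; exact α.2.2
    rw [hc, one_smul] at h
    rw [Subtype.ext h, hc, one_mul]
    exact le_rfl
  | cons y w ih =>
    have hnn : ∀ z, 0 ≤ H.weight z α * H.markovOp^[w.length] g (H.next z α) := fun z =>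
      mul_nonneg (H.weight_nonneg z α) (H.iterate_markovOp_nonneg hg _ _)
    have hstep : H.weight y α * H.markovOp^[w.length] g (H.next y α) ≤
        H.markovOp^[(y :: w).length] g α := by
      rw [List.length_cons, Function.iterate_succ_apply', markovOp_apply]
      exact Finset.single_le_sum
        (f := fun z => H.weight z α * H.markovOp^[w.length] g (H.next z α))
        (fun z _ => hnn z) (Finset.mem_univ y)
    refine le_trans ?_ hstep
    have hpush : α.1 ᵥ* H.step y = H.weight y α • (H.next y α).1 :=
      H.push_eq_weight_smul_next y α
    rw [word_cons, ← vecMul_vecMul, hpush, smul_vecMul] at h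
    by_cases hy : H.weight y α = 0
    · rw [hy, zero_smul] at h
      have hc : c = 0 := by rw [← total h]; simp
      rw [hc, hy, zero_mul, zero_mul]
    · have h' : (H.next y α).1 ᵥ* H.word w = (c / H.weight y α) • γ.1 := by
        rw [div_eq_inv_mul, ← smul_smul, ← h, smul_smul, inv_mul_cancel₀ hy, one_smul]
      have := mul_le_mul_of_nonneg_left (ih h') (H.weight_nonneg y α)
      rwa [← mul_assoc, mul_div_cancel₀ _ hy] at this

end Operator

section Lipschitz

/-- The positively homogeneous extension of `g` to the cone over the simplex is `L`-Lipschitz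
for the `ℓ¹`-norm. -/
def ConeLipschitz (L : ℝ) (g : stdSimplex ℝ X → ℝ) : Prop :=
  ∀ (c c' : ℝ) (α β : stdSimplex ℝ X), 0 ≤ c → 0 ≤ c' →
    |c * g α - c' * g β| ≤ L * ∑ i, |c * α.1 i - c' * β.1 i|

theorem ConeLipschitz.markovOp {L : ℝ} (hL : 0 ≤ L) {g : C(stdSimplex ℝ X, ℝ)}
    (hg : ConeLipschitz L g) : ConeLipschitz L (H.markovOp g) := by
  intro c c' α β hc hc'
  have hterm : ∀ y j, |c * H.weight y α * (H.next y α).1 j -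
      c' * H.weight y β * (H.next y β).1 j| ≤ ∑ i, |c * α.1 i - c' * β.1 i| * H.step y i j := by
    intro y j
    rw [mul_assoc, mul_assoc, weight_mul_next, weight_mul_next, Finset.mul_sum, Finset.mul_sum,
      ← Finset.sum_sub_distrib]
    refine (Finset.abs_sum_le_sum_abs _ _).trans (Finset.sum_le_sum fun i _ => ?_)
    rw [← mul_assoc, ← mul_assoc, ← sub_mul, abs_mul, abs_of_nonneg (H.nonneg y i j)]
  calc |c * H.markovOp g α - c' * H.markovOp g β|
      = |∑ y, (c * H.weight y α * g (H.next y α) - c' * H.weight y β * g (H.next y β))| := by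
        rw [markovOp_apply, markovOp_apply, Finset.mul_sum, Finset.mul_sum,
          ← Finset.sum_sub_distrib]
        simp only [mul_assoc]
    _ ≤ ∑ y, |c * H.weight y α * g (H.next y α) - c' * H.weight y β * g (H.next y β)| :=
        Finset.abs_sum_le_sum_abs _ _
    _ ≤ ∑ y, L * ∑ j, ∑ i, |c * α.1 i - c' * β.1 i| * H.step y i j := by
        refine Finset.sum_le_sum fun y _ => ?_
        refine (hg _ _ _ _ (mul_nonneg hc (H.weight_nonneg y α))
          (mul_nonneg hc' (H.weight_nonneg y β))).trans ?_
        exact mul_le_mul_of_nonneg_left (Finset.sum_le_sum fun j _ => hterm y j) hL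
    _ = L * ∑ i, |c * α.1 i - c' * β.1 i| * ∑ y, ∑ j, H.step y i j := by
        rw [← Finset.mul_sum]
        congr 1
        simp only [Finset.mul_sum]
        rw [Finset.sum_comm' (t' := Finset.univ) (s' := fun _ => Finset.univ) (by simp)]
        rw [Finset.sum_congr rfl fun j _ => Finset.sum_comm, Finset.sum_comm]
        exact Finset.sum_congr rfl fun i _ => Finset.sum_comm
    _ = L * ∑ i, |c * α.1 i - c' * β.1 i| := by simp only [sum_sum_step, mul_one]

theorem ConeLipschitz.iterate_markovOp {L : ℝ} (hL : 0 ≤ L) {g : C(stdSimplex ℝ X, ℝ)}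
    (hg : ConeLipschitz L g) (n : ℕ) : ConeLipschitz L (H.markovOp^[n] g) := by
  induction n with
  | zero => exact hg
  | succ n ih =>
    rw [Function.iterate_succ_apply']
    exact ih.markovOp H hL

theorem exists_coneLipschitz {K : NNReal} {f : C(stdSimplex ℝ X, ℝ)} (hf : LipschitzWith K f) :
    ∃ L, 0 ≤ L ∧ ConeLipschitz L f := by
  refine ⟨‖f‖ + 2 * K, by positivity, fun c c' α β hc hc' => ?_⟩
  set S := ∑ i, |c * α.1 i - c' * β.1 i| with hS
  have hcc : |c - c'| ≤ S := by
    have : c - c' = ∑ i, (c * α.1 i - c' * β.1 i) := by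
      rw [Finset.sum_sub_distrib, ← Finset.mul_sum, ← Finset.mul_sum]
      have h1 := α.2.2
      have h2 := β.2.2
      rw [h1, h2, mul_one, mul_one]
    rw [this]
    exact Finset.abs_sum_le_sum_abs _ _
  have hdist : c' * dist α β ≤ 2 * S := by
    have h1 : dist α β ≤ ∑ i, |α.1 i - β.1 i| := by
      rw [Subtype.dist_eq]
      refine (dist_pi_le_iff (Finset.sum_nonneg fun i _ => abs_nonneg _)).2 fun i => ?_
      rw [Real.dist_eq]
      exact Finset.single_le_sum (f := fun i => |α.1 i - β.1 i|) (fun i _ => abs_nonneg _)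
        (Finset.mem_univ i)
    have h2 : ∀ i, c' * |α.1 i - β.1 i| ≤ |c - c'| * α.1 i + |c * α.1 i - c' * β.1 i| := by
      intro i
      have e : c' * (α.1 i - β.1 i) = -((c - c') * α.1 i) + (c * α.1 i - c' * β.1 i) := by ring
      rw [← abs_of_nonneg hc', ← abs_mul, abs_of_nonneg hc', e]
      refine (abs_add_le _ _).trans ?_
      rw [abs_neg, abs_mul, abs_of_nonneg (α.2.1 i)]
    calc c' * dist α β ≤ c' * ∑ i, |α.1 i - β.1 i| := mul_le_mul_of_nonneg_left h1 hc'
      _ = ∑ i, c' * |α.1 i - β.1 i| := Finset.mul_sum _ _ _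
      _ ≤ ∑ i, (|c - c'| * α.1 i + |c * α.1 i - c' * β.1 i|) := Finset.sum_le_sum fun i _ => h2 i
      _ = |c - c'| + S := by
          rw [Finset.sum_add_distrib, ← Finset.mul_sum]
          have h1 := α.2.2
          rw [h1, mul_one]
      _ ≤ 2 * S := by linarith
  have hlip : |f α - f β| ≤ K * dist α β := by
    rw [← Real.dist_eq]
    exact hf.dist_le_mul α β
  have hfα : |f α| ≤ ‖f‖ := f.norm_coe_le_norm α
  have e : c * f α - c' * f β = (c - c') * f α + c' * (f α - f β) := by ring
  rw [e]
  calc |(c - c') * f α + c' * (f α - f β)| ≤ |c - c'| * |f α| + c' * |f α - f β| := by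
        refine (abs_add_le _ _).trans ?_
        rw [abs_mul, abs_mul, abs_of_nonneg hc']
    _ ≤ S * ‖f‖ + c' * (K * dist α β) :=
        add_le_add (mul_le_mul hcc hfα (abs_nonneg _) ((abs_nonneg _).trans hcc))
          (mul_le_mul_of_nonneg_left hlip hc')
    _ = S * ‖f‖ + K * (c' * dist α β) := by ring
    _ ≤ S * ‖f‖ + K * (2 * S) := by gcongr
    _ = (‖f‖ + 2 * K) * S := by ring

end Lipschitz

section Oscillation

theorem exists_bounds_of_osc_le [Nonempty X] {g : C(stdSimplex ℝ X, ℝ)} {d : ℝ}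
    (h : ∀ α β, g α - g β ≤ d) :
    ∃ lo hi, hi - lo ≤ d ∧ ContinuousMap.const _ lo ≤ g ∧ g ≤ ContinuousMap.const _ hi := by
  obtain ⟨a, -, ha⟩ := isCompact_univ.exists_isMaxOn Set.univ_nonempty g.continuous.continuousOn
  obtain ⟨b, -, hb⟩ := isCompact_univ.exists_isMinOn Set.univ_nonempty g.continuous.continuousOn
  exact ⟨g b, g a, h a b, fun x => hb (Set.mem_univ x), fun x => ha (Set.mem_univ x)⟩

theorem iterate_markovOp_osc_le [Nonempty X] {g : C(stdSimplex ℝ X, ℝ)} {d : ℝ}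
    (h : ∀ α β, g α - g β ≤ d) (n : ℕ) (α β : stdSimplex ℝ X) :
    H.markovOp^[n] g α - H.markovOp^[n] g β ≤ d := by
  obtain ⟨lo, hi, hd, hlo, hhi⟩ := exists_bounds_of_osc_le h
  have h1 := H.iterate_markovOp_mono hlo n
  have h2 := H.iterate_markovOp_mono hhi n
  rw [iterate_markovOp_const] at h1 h2
  have h3 : lo ≤ H.markovOp^[n] g β := h1 β
  have h4 : H.markovOp^[n] g α ≤ hi := h2 α
  linarith

theorem iterate_markovOp_osc_contract [DecidableEq X] [Nonempty X] {L ε p : ℝ} {m : ℕ}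
    (hL : 0 ≤ L) (hp : 0 < p)
    (hmerge : ∀ α β : stdSimplex ℝ X, ∃ (x x' : List Y) (c c' : ℝ) (γ γ' : stdSimplex ℝ X),
      x.length = m ∧ x'.length = m ∧ p ≤ c ∧ p ≤ c' ∧ α.1 ᵥ* H.word x = c • γ.1 ∧
        β.1 ᵥ* H.word x' = c' • γ'.1 ∧ ∑ j, |γ.1 j - γ'.1 j| ≤ ε)
    {g : C(stdSimplex ℝ X, ℝ)} (hg : ConeLipschitz L g) {d : ℝ} (hp1 : p ≤ 1)
    (h : ∀ α β, g α - g β ≤ d) (α β : stdSimplex ℝ X) :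
    H.markovOp^[m] g α - H.markovOp^[m] g β ≤ (1 - p) * d + p * (L * ε) := by
  obtain ⟨lo, hi, hd, hlo, hhi⟩ := exists_bounds_of_osc_le h
  obtain ⟨x, x', c, c', γ, γ', hx, hx', hc, hc', hγ, hγ', hdist⟩ := hmerge α β
  have h1 := H.mul_le_iterate_markovOp (sub_nonneg.2 hhi) x hγ
  have h2 := H.mul_le_iterate_markovOp (sub_nonneg.2 hlo) x' hγ'
  rw [hx, iterate_markovOp_sub, iterate_markovOp_const] at h1
  rw [hx', iterate_markovOp_sub, iterate_markovOp_const] at h2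
  simp only [ContinuousMap.sub_apply, ContinuousMap.const_apply] at h1 h2
  have h3 : g γ - g γ' ≤ L * ε := by
    have := hg 1 1 γ γ' zero_le_one zero_le_one
    simp only [one_mul] at this
    exact (le_abs_self _).trans (this.trans (mul_le_mul_of_nonneg_left hdist hL))
  have h4 : p * (hi - g γ) ≤ c * (hi - g γ) :=
    mul_le_mul_of_nonneg_right hc (sub_nonneg.2 (hhi γ))
  have h5 : p * (g γ' - lo) ≤ c' * (g γ' - lo) :=
    mul_le_mul_of_nonneg_right hc' (sub_nonneg.2 (hlo γ'))
  have h6 : p * (g γ - g γ') ≤ p * (L * ε) := mul_le_mul_of_nonneg_left h3 hp.le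
  have h7 : (1 - p) * (hi - lo) ≤ (1 - p) * d :=
    mul_le_mul_of_nonneg_left hd (sub_nonneg.2 hp1)
  linarith

/-- The oscillation of the iterates `T^n f` of a Lipschitz function tends to zero. -/
theorem eventually_iterate_markovOp_osc_le [DecidableEq X] [Nonempty X]
    (haper : H.transition.IsPrimitive)
    (hsub : ∃ y : List Y, H.word y ≠ 0 ∧ IsSubrectangular (H.word y))
    {K : NNReal} {f : C(stdSimplex ℝ X, ℝ)} (hf : LipschitzWith K f) {ε : ℝ} (hε : 0 < ε) :
    ∀ᶠ n in atTop, ∀ α β, H.markovOp^[n] f α - H.markovOp^[n] f β ≤ ε := by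
  obtain ⟨L, hL, hfL⟩ := exists_coneLipschitz hf
  have hη : 0 < ε / (2 * (L + 1)) := by positivity
  obtain ⟨m, p, hp, hmerge⟩ := H.exists_merging_words haper hsub hη
  set η := ε / (2 * (L + 1)) with hη'
  have hLη : L * η ≤ ε / 2 := by
    have : (L + 1) * η = ε / 2 := by rw [hη']; field_simp
    linarith
  have hp1 : p ≤ 1 := by
    obtain ⟨α⟩ : Nonempty (stdSimplex ℝ X) := inferInstance
    obtain ⟨x, -, c, -, γ, -, -, -, hc, -, hγ, -⟩ := hmerge α α
    have := H.mul_le_iterate_markovOp (g := ContinuousMap.const _ 1)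
      (fun _ => zero_le_one) x hγ
    rw [iterate_markovOp_const] at this
    simp only [ContinuousMap.const_apply, mul_one] at this
    exact hc.trans this
  have hosc : ∀ j : ℕ, ∀ α β, H.markovOp^[m * j] f α - H.markovOp^[m * j] f β ≤
      (1 - p) ^ j * (2 * ‖f‖) + L * η := by
    intro j
    induction j with
    | zero =>
      intro α β
      have h1 := (abs_le.1 (f.norm_coe_le_norm α)).2
      have h2 := (abs_le.1 (f.norm_coe_le_norm β)).1
      have : 0 ≤ L * η := by positivity
      simp only [mul_zero, Function.iterate_zero, id_eq, pow_zero, one_mul]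
      linarith
    | succ j ih =>
      intro α β
      have := H.iterate_markovOp_osc_contract hL hp hmerge
        (hfL.iterate_markovOp H hL (m * j)) hp1 ih α β
      rw [← Function.iterate_add_apply, show m + m * j = m * (j + 1) by ring] at this
      refine this.trans (le_of_eq ?_)
      ring
  have hlim : Tendsto (fun j : ℕ => (1 - p) ^ j * (2 * ‖f‖)) atTop (𝓝 0) := by
    simpa using (tendsto_pow_atTop_nhds_zero_of_lt_one (sub_nonneg.2 hp1)
      (show 1 - p < 1 by linarith)).mul_const (2 * ‖f‖)
  obtain ⟨j, hj⟩ := (hlim.eventually_lt_const (half_pos hε)).exists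
  filter_upwards [eventually_ge_atTop (m * j)] with n hn α β
  obtain ⟨k, rfl⟩ := Nat.exists_eq_add_of_le hn
  rw [add_comm, Function.iterate_add_apply]
  refine H.iterate_markovOp_osc_le (fun α β => (hosc j α β).trans ?_) k α β
  linarith

end Oscillation

section Invariant

theorem integrable_continuousMap (μ : ProbabilityMeasure (stdSimplex ℝ X))
    (f : C(stdSimplex ℝ X, ℝ)) : Integrable f (μ : Measure (stdSimplex ℝ X)) :=
  (BoundedContinuousFunction.mkOfCompact f).integrable _

theorem integral_iterate_dualOp (μ : ProbabilityMeasure (stdSimplex ℝ X))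
    (f : C(stdSimplex ℝ X, ℝ)) (n : ℕ) :
    ∫ α, f α ∂(H.dualOp^[n] μ : Measure (stdSimplex ℝ X)) =
      ∫ α, H.markovOp^[n] f α ∂(μ : Measure (stdSimplex ℝ X)) := by
  induction n generalizing μ with
  | zero => rfl
  | succ n ih => rw [Function.iterate_succ_apply, ih, integral_dualOp, Function.iterate_succ_apply']

theorem abs_integral_sub_integral_le [Nonempty X] (μ ν : ProbabilityMeasure (stdSimplex ℝ X))
    {g : C(stdSimplex ℝ X, ℝ)} {d : ℝ} (h : ∀ α β, g α - g β ≤ d) :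
    |∫ α, g α ∂(μ : Measure (stdSimplex ℝ X)) - ∫ α, g α ∂(ν : Measure (stdSimplex ℝ X))| ≤ d := by
  obtain ⟨lo, hi, hd, hlo, hhi⟩ := exists_bounds_of_osc_le h
  have key : ∀ ρ : ProbabilityMeasure (stdSimplex ℝ X),
      lo ≤ ∫ α, g α ∂(ρ : Measure (stdSimplex ℝ X)) ∧
        ∫ α, g α ∂(ρ : Measure (stdSimplex ℝ X)) ≤ hi := by
    intro ρ
    have h1 := integral_mono (integrable_const lo) (integrable_continuousMap ρ g) hlo
    have h2 := integral_mono (integrable_continuousMap ρ g) (integrable_const hi) hhi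
    simp only [integral_const, probReal_univ, smul_eq_mul, one_mul] at h1 h2
    exact ⟨h1, h2⟩
  have h1 := key μ
  have h2 := key ν
  rw [abs_le]
  constructor <;> linarith [h1.1, h1.2, h2.1, h2.2]

/-- The laws of the chain started from two initial distributions merge. -/
theorem tendsto_integral_iterate_dualOp_sub [DecidableEq X] [Nonempty X]
    (haper : H.transition.IsPrimitive)
    (hsub : ∃ y : List Y, H.word y ≠ 0 ∧ IsSubrectangular (H.word y))
    {K : NNReal} {f : C(stdSimplex ℝ X, ℝ)} (hf : LipschitzWith K f)
    (μ ν : ProbabilityMeasure (stdSimplex ℝ X)) :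
    Tendsto (fun n => ∫ α, f α ∂(H.dualOp^[n] μ : Measure (stdSimplex ℝ X)) -
      ∫ α, f α ∂(H.dualOp^[n] ν : Measure (stdSimplex ℝ X))) atTop (𝓝 0) := by
  refine Metric.tendsto_nhds.2 fun ε hε => ?_
  filter_upwards [H.eventually_iterate_markovOp_osc_le haper hsub hf (half_pos hε)] with n hn
  rw [Real.dist_0_eq_abs, integral_iterate_dualOp, integral_iterate_dualOp]
  exact (abs_integral_sub_integral_le μ ν hn).trans_lt (half_lt_self hε)

theorem IsInvariant.tendsto_iterate_dualOp [DecidableEq X] [Nonempty X]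
    (haper : H.transition.IsPrimitive)
    (hsub : ∃ y : List Y, H.word y ≠ 0 ∧ IsSubrectangular (H.word y))
    {lam : ProbabilityMeasure (stdSimplex ℝ X)} (hlam : H.IsInvariant lam)
    (μ : ProbabilityMeasure (stdSimplex ℝ X)) :
    Tendsto (fun n : ℕ => H.dualOp^[n] μ) atTop (𝓝 lam) := by
  refine tendsto_iff_forall_lipschitz_integral_tendsto.2 fun f _ ⟨K, hK⟩ => ?_
  have := H.tendsto_integral_iterate_dualOp_sub haper hsub (f := ⟨f, hK.continuous⟩) hK μ lam
  have hfix : ∀ n, H.dualOp^[n] lam = lam :=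
    Function.iterate_fixed ((H.isInvariant_iff lam).1 hlam)
  simp only [hfix, ContinuousMap.coe_mk] at this
  simpa using this.add_const (∫ α, f α ∂(lam : Measure (stdSimplex ℝ X)))

theorem exists_isInvariant [DecidableEq X] [Nonempty X] (haper : H.transition.IsPrimitive)
    (hsub : ∃ y : List Y, H.word y ≠ 0 ∧ IsSubrectangular (H.word y)) :
    ∃ lam : ProbabilityMeasure (stdSimplex ℝ X), H.IsInvariant lam := by
  obtain ⟨α₀⟩ : Nonempty (stdSimplex ℝ X) := inferInstance
  set μ : ProbabilityMeasure (stdSimplex ℝ X) := ⟨Measure.dirac α₀, inferInstance⟩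
  obtain ⟨U, hU⟩ : ∃ U : Ultrafilter ℕ, (U : Filter ℕ) ≤ atTop := Ultrafilter.exists_le atTop
  obtain ⟨lam, -, hlam⟩ := isCompact_univ.ultrafilter_le_nhds
    (U.map fun n => H.dualOp^[n] μ) (by simp)
  have hlim : Tendsto (fun n => H.dualOp^[n] μ) U (𝓝 lam) := hlam
  have hint : ∀ f : C(stdSimplex ℝ X, ℝ), Tendsto
      (fun n => ∫ α, f α ∂(H.dualOp^[n] μ : Measure (stdSimplex ℝ X))) U
      (𝓝 (∫ α, f α ∂(lam : Measure (stdSimplex ℝ X)))) := fun f =>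
    ProbabilityMeasure.tendsto_iff_forall_integral_tendsto.1 hlim
      (BoundedContinuousFunction.mkOfCompact f)
  refine ⟨lam, (H.isInvariant_iff lam).2 ?_⟩
  have hconst : Tendsto (fun _ : ℕ => H.dualOp lam) atTop (𝓝 lam) := by
    refine tendsto_iff_forall_lipschitz_integral_tendsto.2 fun f _ ⟨K, hK⟩ => ?_
    set g : C(stdSimplex ℝ X, ℝ) := ⟨f, hK.continuous⟩
    have h1 := hint g
    have h2 := hint (H.markovOp g)
    have h3 := (H.tendsto_integral_iterate_dualOp_sub haper hsub (f := g) hK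
      (H.dualOp μ) μ).mono_left hU
    have h4 : ∫ α, g α ∂(H.dualOp lam : Measure (stdSimplex ℝ X)) =
        ∫ α, g α ∂(lam : Measure (stdSimplex ℝ X)) := by
      rw [integral_dualOp]
      refine sub_eq_zero.1 (tendsto_nhds_unique (h2.sub h1) (h3.congr fun n => ?_))
      rw [← Function.iterate_succ_apply, Function.iterate_succ_apply', integral_dualOp]
    change Tendsto (fun _ : ℕ => ∫ α, g α ∂(H.dualOp lam : Measure (stdSimplex ℝ X))) atTop
      (𝓝 (∫ α, g α ∂(lam : Measure (stdSimplex ℝ X))))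
    rw [h4]
    exact tendsto_const_nhds
  exact tendsto_nhds_unique tendsto_const_nhds hconst

end Invariant

end SteppingFamily

theorem theoremA {X Y : Type*} [Fintype X] [DecidableEq X] [Fintype Y]
    (H : SteppingFamily X Y)
    (haper : H.transition.IsPrimitive)
    (hsub : ∃ y : List Y, H.word y ≠ 0 ∧ IsSubrectangular (H.word y)) :
    ∃ lam : ProbabilityMeasure (stdSimplex ℝ X),
      H.IsInvariant lam ∧
      (∀ ν : ProbabilityMeasure (stdSimplex ℝ X), H.IsInvariant ν → ν = lam) ∧
      ∀ μ : ProbabilityMeasure (stdSimplex ℝ X),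
        Tendsto (fun n : ℕ => H.dualOp^[n] μ) atTop (𝓝 lam) := by
  have : Nonempty X := by
    by_contra hX
    rw [not_nonempty_iff] at hX
    obtain ⟨y, hy, -⟩ := hsub
    exact hy (Matrix.ext fun i => isEmptyElim i)
  obtain ⟨lam, hlam⟩ := H.exists_isInvariant haper hsub
  refine ⟨lam, hlam, fun ν hν => ?_, hlam.tendsto_iterate_dualOp H haper hsub⟩
  have h := hlam.tendsto_iterate_dualOp H haper hsub ν
  simp only [Function.iterate_fixed ((H.isInvariant_iff ν).1 hν)] at h
  exact tendsto_nhds_unique tendsto_const_nhds h
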